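/- **Setting.** Let $\mathbf A\in\mathbb R^{s\times s}$, $\mathbf b\in\mathbb R^s$ ($s\ge1$) be the coefficients of a Runge–Kutta method, let $r(z)=1+z\,\mathbf b^T(I-z\mathbf A)^{-1}\mathbb 1$ with $\mathbb 1=(1,\dots,1)^T$, $\mathbf q(z)=\mathbf b^T(I-z\mathbf A)^{-1}$, and assume: $|r(z)|\le1$ for $\operatorname{Re}z\le0$; the order is at least one ($\sum_i b_i=1$); $|r(iy)|<1$ for real $y\ne0$; $\mathbf A$ is invertible; and $\mathbf b^T\mathbf A^{-1}=(0,\dots,0,1)$. Let $\mathbf e_n(z)$ be the last row of $\mathbf E_n(z)$, where $$\Big(\big(\mathbf A+\tfrac{\zeta}{1-\zeta}\mathbb 1\mathbf b^T\big)^{-1}-zI\Big)^{-1}=\sum_{n\ge0}\mathbf E_n(z)\,\zeta^n .$$ Fix a norm $\|\cdot\|$ on $\mathbb C^s$ and constants $\nu>1$, $b>0$, $C_{\mathbf q}>0$ such that $I-z\mathbf A$ is invertible and $\|\mathbf q(z)\|\le C_{\mathbf q}$ for $\operatorname{Re}z\le b$, and $|r(z)|\le e^{\nu\operatorname{Re}z}$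 for $0\le\operatorname{Re}z\le b$. Let $h,L_0>0$, $x\in\mathbb R$, $d=|x|$, $n\ge0$ and $Q\ge1$ integers, $t_n=nh$. Let $K(z,x)=\frac{1}{2\sqrt{z/i}}e^{-|x|\sqrt{z/i}}$ with $\sqrt{z/i}=e^{-i\pi/4}\sqrt z$ (branch of $\sqrt z$ with positive real part, cut along $(-\infty,0]$), let $G(\lambda,x)=K(\lambda e^{-i\pi},x)-K(\lambda e^{i\pi},x)$, where for $\lambda>0$ the two terms are the boundary values of $K$ on the lower and the upper side of the cut, and $$\mathbf I_{n,0}=\frac{h}{2\pi i}\int_0^{L_0}G(\lambda,x)\,\mathbf e_n(-h\lambda)\,d\lambda=\int_{-1}^1(1+y)^{-1/2}\mathbf g(y)\,dy,$$ $$\mathbf g(y)=\frac{hL_0}{4\pi i}\sqrt{1+y}\;G\big(\tfrac{(1+y)L_0}2,x\big)\,\mathbf e_n\big(-\tfrac{h(1+y)L_0}2\big).$$ Let $\boldsymbol\tau_{n,0}(Q)=\mathbf I_{n,0}-\sum_{j=1}^Q w_j\,\mathbf g(y_j)$ be the error of the $Q$-node Gauss–Jacobi rule with weight $(1+y)^{-1/2}$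 on $[-1,1]$ (distinct nodes $y_j\in(-1,1)$, exact for polynomials of degree at most $2Q-1$). Put $D=d\sqrt{3L_0/2}+\nu t_nL_0/2$, $$\varrho_{\max}=1+\frac{2b}{L_0h}+\sqrt{\Big(\frac{2b}{L_0h}\Big)^2+\frac{4b}{L_0h}},\qquad \varrho_{opt}=\frac{2Q}{D}+\sqrt{1+\Big(\frac{2Q}{D}\Big)^2}$$ ($\varrho_{opt}=+\infty$ if $D=0$), and assume $\varrho_{\max}\ge2+\sqrt3$. **Theorem.** If $\varrho_{opt}\in(2+\sqrt3,\varrho_{\max})$, then $$\|\boldsymbol\tau_{n,0}(Q)\|\le C_{\mathbf q}\,h\,\frac{4\sqrt{L_0}}{\pi}\,\frac{\varrho_{opt}}{\varrho_{opt}-1}\left(\frac{e\,\big(d\sqrt{3L_0/2}+\nu t_nL_0/2\big)}{4Q}\right)^{2Q}.$$ Otherwise $$\|\boldsymbol\tau_{n,0}(Q)\|\le C_{\mathbf q}\,h\,\frac{4\sqrt{L_0}}{\pi}\,\frac{\varrho_{\max}^{-2Q+1}}{\varrho_{\max}-1}\,\exp\!\left(\frac bh\Big(d\sqrt{6/L_0}+\nu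 t_n\Big)\right).$$ -/

import Mathlib

open MeasureTheory Matrix

noncomputable section

namespace SchrodingerCQ

/-! ### Runge-Kutta methods

A method has `s + 1` stages and is given by the real Butcher coefficients `A` and `b`. -/

/-- The coefficient matrix viewed as a complex matrix. -/
def complexMatrix {s : ℕ} (A : Matrix (Fin (s + 1)) (Fin (s + 1)) ℝ) :
    Matrix (Fin (s + 1)) (Fin (s + 1)) ℂ :=
  A.map (fun a => (a : ℂ))

/-- The weight vector viewed as a complex vector. -/
def complexVector {s : ℕ} (b : Fin (s + 1) → ℝ) : Fin (s + 1) → ℂ :=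
  fun i => (b i : ℂ)

/-- The row vector `q(z) = bᵀ (I - z A)⁻¹`. -/
def qVector {s : ℕ} (A : Matrix (Fin (s + 1)) (Fin (s + 1)) ℝ) (b : Fin (s + 1) → ℝ) (z : ℂ) :
    Fin (s + 1) → ℂ :=
  complexVector b ᵥ* (1 - z • complexMatrix A)⁻¹

/-- The stability function `r(z) = 1 + z bᵀ (I - z A)⁻¹ 𝟙`. -/
def stabilityFunction {s : ℕ} (A : Matrix (Fin (s + 1)) (Fin (s + 1)) ℝ)
    (b : Fin (s + 1) → ℝ) (z : ℂ) : ℂ :=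
  1 + z * (complexVector b ⬝ᵥ ((1 - z • complexMatrix A)⁻¹ *ᵥ (1 : Fin (s + 1) → ℂ)))

/-- The standing assumptions on the Runge-Kutta method. -/
structure RungeKuttaAssumption {s : ℕ} (A : Matrix (Fin (s + 1)) (Fin (s + 1)) ℝ)
    (b : Fin (s + 1) → ℝ) : Prop where
  /-- A-stability -/
  aStable : ∀ z : ℂ, z.re ≤ 0 → ‖stabilityFunction A b z‖ ≤ 1
  /-- classical order at least one -/
  order_one : ∑ i, b i = 1
  /-- strict bound on the punctured imaginary axis -/
  strict : ∀ y : ℝ, y ≠ 0 → ‖stabilityFunction A b (Complex.I * y)‖ < 1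
  /-- the coefficient matrix is invertible -/
  invertible : IsUnit A
  /-- stiff accuracy, `bᵀ A⁻¹ = (0, …, 0, 1)` -/
  stifflyAccurate : b ᵥ* A⁻¹ = Pi.single (Fin.last s) 1

/-- The symbol `Δ(ζ) = (A + ζ / (1 - ζ) 𝟙 bᵀ)⁻¹`, as a matrix of power series in `ζ`. -/
def symbol {s : ℕ} (A : Matrix (Fin (s + 1)) (Fin (s + 1)) ℝ) (b : Fin (s + 1) → ℝ) :
    Matrix (Fin (s + 1)) (Fin (s + 1)) (PowerSeries ℂ) :=
  ((complexMatrix A).map (fun a => PowerSeries.C a)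
    + ((PowerSeries.X : PowerSeries ℂ) * (1 - PowerSeries.X)⁻¹) •
      (vecMulVec (1 : Fin (s + 1) → ℂ) (complexVector b)).map (fun a => PowerSeries.C a))⁻¹

/-- The matrices `E_n(z)` given by `(Δ(ζ) - z I)⁻¹ = ∑ₙ E_n(z) ζⁿ`. -/
def EMatrix {s : ℕ} (A : Matrix (Fin (s + 1)) (Fin (s + 1)) ℝ) (b : Fin (s + 1) → ℝ)
    (n : ℕ) (z : ℂ) : Matrix (Fin (s + 1)) (Fin (s + 1)) ℂ :=
  ((symbol A b - (PowerSeries.C z : PowerSeries ℂ) • 1)⁻¹).map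
    (fun p => PowerSeries.coeff n p)

/-- The row vector `e_n(z)`, the last row of `E_n(z)`. -/
def eVector {s : ℕ} (A : Matrix (Fin (s + 1)) (Fin (s + 1)) ℝ) (b : Fin (s + 1) → ℝ)
    (n : ℕ) (z : ℂ) : Fin (s + 1) → ℂ :=
  fun j => EMatrix A b n z (Fin.last s) j

/-- `ν > 1`, `β > 0`, `Cq > 0` are constants for which
`|r(z)| ≤ exp (ν Re z)` for `0 ≤ Re z ≤ β` and `‖q(z)‖ ≤ Cq` for `Re z ≤ β`, the inverse in the
definitions of `r` and `q` being a genuine inverse on the half-plane `Re z ≤ β`.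
`N` is the norm on row vectors that is used. -/
structure IsBoundConstants {s : ℕ} (A : Matrix (Fin (s + 1)) (Fin (s + 1)) ℝ)
    (b : Fin (s + 1) → ℝ) (N : Seminorm ℂ (Fin (s + 1) → ℂ)) (ν β Cq : ℝ) : Prop where
  one_lt_nu : 1 < ν
  beta_pos : 0 < β
  Cq_pos : 0 < Cq
  defined : ∀ z : ℂ, z.re ≤ β → IsUnit (1 - z • complexMatrix A)
  r_bound : ∀ z : ℂ, 0 ≤ z.re → z.re ≤ β → ‖stabilityFunction A b z‖ ≤ Real.exp (ν * z.re)
  q_bound : ∀ z : ℂ, z.re ≤ β → N (qVector A b z) ≤ Cq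

/-! ### The one-dimensional Schrödinger transfer function -/

/-- The one-dimensional transfer function `K(z, x) = exp (-|x| √(z/i)) / (2 √(z/i))`, with
`√(z/i) = e^{-iπ/4} √z`, at the point `z = lam e^{iθ}`, `lam > 0`, `-π ≤ θ ≤ π`, where
`√z = √lam e^{iθ/2}` is the principal square root for `-π < θ < π` and, for `θ = ±π`,
its boundary value on the corresponding side of the cut. -/
def transferK (lam θ x : ℝ) : ℂ :=
  let sqrtz : ℂ := (Real.sqrt lam : ℂ) * Complex.exp (Complex.I * θ / 2)
  let σ : ℂ := Complex.exp (-(Complex.I * Real.pi / 4)) * sqrtz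
  1 / (2 * σ) * Complex.exp (-((|x| : ℝ) : ℂ) * σ)

/-- The jump `G(lam, x) = K(lam e^{-iπ}, x) - K(lam e^{iπ}, x)` across the cut. -/
def jumpG (lam x : ℝ) : ℂ :=
  transferK lam (-Real.pi) x - transferK lam Real.pi x

/-- `I_{n,0} = h / (2πi) ∫_0^{L₀} G(lam, x) e_n(-h lam) dlam`. -/
def initialIntegral {s : ℕ} (A : Matrix (Fin (s + 1)) (Fin (s + 1)) ℝ) (b : Fin (s + 1) → ℝ)
    (h L₀ x : ℝ) (n : ℕ) : Fin (s + 1) → ℂ :=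
  ((h : ℂ) / (2 * Real.pi * Complex.I)) •
    ∫ lam in (0 : ℝ)..L₀, jumpG lam x • eVector A b n (-(h : ℂ) * lam)

/-! ### Gauss quadrature -/

/-- `Q` distinct nodes in `(-1, 1)` with real weights form the `Q`-node Gauss rule for the weight
function `w` on `[-1, 1]`: the rule is exact for all polynomials of degree at most `2Q - 1`. -/
structure IsGaussRule (w : ℝ → ℝ) (Q : ℕ) (node weight : Fin Q → ℝ) : Prop where
  injective : Function.Injective node
  mem_Ioo : ∀ j, node j ∈ Set.Ioo (-1 : ℝ) 1
  exact : ∀ p : Polynomial ℝ, p.natDegree < 2 * Q →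
    ∑ j, weight j * p.eval (node j) = ∫ y in (-1 : ℝ)..1, w y * p.eval y

/-- The Jacobi weight `(1 + y)^{-1/2}`. -/
def jacobiWeight (y : ℝ) : ℝ := (1 + y) ^ (-(1 / 2) : ℝ)

/-- After the substitution `lam = (1 + y) L₀ / 2`, the integral `I_{n,0}` is
`∫_{-1}^1 (1 + y)^{-1/2} g(y) dy`; this is the function `g`, that is, the transformed
integrand divided by the Jacobi weight. -/
def smoothFactor {s : ℕ} (A : Matrix (Fin (s + 1)) (Fin (s + 1)) ℝ) (b : Fin (s + 1) → ℝ)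
    (h L₀ x : ℝ) (n : ℕ) (y : ℝ) : Fin (s + 1) → ℂ :=
  ((h : ℂ) * L₀ / (4 * Real.pi * Complex.I) * (Real.sqrt (1 + y) : ℂ)
      * jumpG ((1 + y) * L₀ / 2) x) •
    eVector A b n (-(h : ℂ) * ((1 + y) * L₀ / 2))

/-- The error `τ_{n,0}(Q)` of the quadrature rule applied to `I_{n,0}`. -/
def quadratureError {s : ℕ} (A : Matrix (Fin (s + 1)) (Fin (s + 1)) ℝ) (b : Fin (s + 1) → ℝ)
    (h L₀ x : ℝ) (n : ℕ) {Q : ℕ} (node weight : Fin Q → ℝ) : Fin (s + 1) → ℂ :=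
  initialIntegral A b h L₀ x n
    - ∑ j, (weight j : ℂ) • smoothFactor A b h L₀ x n (node j)

/-! ### The parameters of the bound -/

/-- `ρ_max = 1 + 2β/(L₀h) + √((2β/(L₀h))² + 4β/(L₀h))`. -/
def rhoMax (β L₀ h : ℝ) : ℝ :=
  1 + 2 * β / (L₀ * h) + Real.sqrt ((2 * β / (L₀ * h)) ^ 2 + 4 * β / (L₀ * h))

/-- `d √(3L₀/2) + ν t L₀/2`. -/
def growth (d ν t L₀ : ℝ) : ℝ :=
  d * Real.sqrt (3 * L₀ / 2) + ν * t * L₀ / 2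

/-- `ρ_opt = 2Q/D + √(1 + (2Q/D)²)` with `D = d √(3L₀/2) + ν t L₀/2`. -/
def rhoOpt (d ν t L₀ : ℝ) (Q : ℕ) : ℝ :=
  2 * Q / growth d ν t L₀ + Real.sqrt (1 + (2 * Q / growth d ν t L₀) ^ 2)

end SchrodingerCQ

end

noncomputable section

namespace SchrodingerCQ

/-! ### Chebyshev approximation on Bernstein ellipses -/

/-! The integrand is the Jacobi weight times a function that extends holomorphically, so the Gauss
error decays geometrically at the rate of the largest usable Bernstein ellipse.

Two identities give the extension. Stiff accuracy collapses the last row of the resolvent to `e_n =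
r ^ n q` (`eVector_eq`). On the two sides of the cut `√(z/i)` takes the values `±σ` with `σ =
e^{iπ/4} √λ`, so `G = -cosh (|x| σ) / σ` (`jumpG_eq`); the factor `√(1 + y)` removes the pole `1 /
σ`, and `cosh` is even, hence entire in `σ² = iλ`. Only `r` and `q` restrict the domain: the real
part of their argument must not exceed `β`.

A Gauss rule has nonnegative weights and is exact up to degree `2Q - 1`, so its error is at most
twice the total mass times the uniform error of a truncated Chebyshev series, which decays like `ρ⁻¹
^ (2Q)`.

With `a = (ρ + ρ⁻¹) / 2` the ellipse lies in the disc of radius `a`, where the extension is bounded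
by a constant times `exp (D (a - 1))`; this uses `a ≥ 2`, that is `ρ ≥ 2 + √3`, and `h L₀ (a - 1) /
2 ≤ β`, that is `ρ ≤ ρ_max`. The stationary point of `ρ⁻¹ ^ (2Q) exp (D (a - 1))` is `ρ_opt`. The
theorem takes `ρ = ρ_opt` when it is admissible and `ρ = ρ_max` otherwise. -/

/-- The Joukowski map, which sends the circle of radius `ρ` to the Bernstein ellipse. -/
def joukowski (z : ℂ) : ℂ := (z + z⁻¹) / 2

lemma joukowski_inv (z : ℂ) : joukowski z⁻¹ = joukowski z := by
  simp [joukowski, add_comm]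

lemma differentiableAt_joukowski {z : ℂ} (hz : z ≠ 0) : DifferentiableAt ℂ joukowski z := by
  unfold joukowski
  exact (differentiableAt_id.add (differentiableAt_inv hz)).div_const 2

lemma joukowski_exp (θ : ℝ) : joukowski (Complex.exp (θ * Complex.I)) = (Real.cos θ : ℂ) := by
  rw [joukowski, ← Complex.exp_neg, Complex.ofReal_cos, Complex.cos]
  ring_nf

lemma add_inv_le_add_inv {x y : ℝ} (hx : 1 ≤ x) (hxy : x ≤ y) : x + x⁻¹ ≤ y + y⁻¹ := by
  have hx0 : 0 < x := by linarith
  have hy0 : 0 < y := by linarith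
  have : y + y⁻¹ - (x + x⁻¹) = (y - x) * (x * y - 1) / (x * y) := by field_simp; ring
  have h2 : 0 ≤ (y - x) * (x * y - 1) / (x * y) :=
    div_nonneg (mul_nonneg (by linarith) (by nlinarith)) (by positivity)
  linarith

lemma norm_joukowski_le {z : ℂ} {ρ : ℝ} (h1 : 1 ≤ ‖z‖) (h2 : ‖z‖ ≤ ρ) :
    ‖joukowski z‖ ≤ (ρ + ρ⁻¹) / 2 := by
  have := add_inv_le_add_inv h1 h2
  have h3 := norm_add_le z z⁻¹
  rw [norm_inv] at h3
  rw [joukowski, norm_div, Complex.norm_ofNat]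
  linarith

lemma fact_two_pi_pos : Fact (0 < 2 * Real.pi) := ⟨Real.two_pi_pos⟩

attribute [local instance] fact_two_pi_pos

/-- The Fourier coefficients of the restriction of `F` to the unit circle are Laurent
coefficients. -/
lemma fourierCoeff_eq_circleIntegral (F : ℂ → ℂ) (k : ℕ) :
    fourierCoeff (fun x : AddCircle (2 * Real.pi) => F (x.toCircle : ℂ)) k =
      (2 * Real.pi * Complex.I : ℂ)⁻¹ • ∮ z in C(0, 1), (z ^ (k + 1))⁻¹ * F z := by
  rw [fourierCoeff_eq_intervalIntegral _ _ 0, circleIntegral, zero_add, Complex.real_smul,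
    smul_eq_mul, _root_.mul_inv_rev, mul_comm (Complex.I)⁻¹, mul_assoc,
    ← intervalIntegral.integral_const_mul (Complex.I)⁻¹]
  push_cast
  rw [one_div]
  congr 1
  apply intervalIntegral.integral_congr
  intro θ _
  have hπ : (Real.pi : ℂ) ≠ 0 := by exact_mod_cast Real.pi_ne_zero
  have h1 : (fourier (-(k : ℤ)) (θ : AddCircle (2 * Real.pi)) : ℂ) =
      (Complex.exp (θ * Complex.I) ^ k)⁻¹ := by
    rw [fourier_coe_apply, ← Complex.exp_nat_mul, ← Complex.exp_neg]
    congr 1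
    push_cast
    field_simp
  have h2 : ((AddCircle.toCircle (θ : AddCircle (2 * Real.pi)) : Circle) : ℂ) =
      Complex.exp (θ * Complex.I) := by
    rw [AddCircle.toCircle_apply_mk, Circle.coe_exp]
    congr 1
    push_cast
    field_simp
  have h3 : Complex.exp (θ * Complex.I) ≠ 0 := Complex.exp_ne_zero _
  simp only [h1, h2, deriv_circleMap, circleMap, smul_eq_mul, zero_add, Complex.ofReal_one, one_mul]
  field_simp
  ring

lemma fourierCoeff_neg_of_even {g : AddCircle (2 * Real.pi) → ℂ} (hg : ∀ x, g (-x) = g x)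
    (k : ℤ) : fourierCoeff g (-k) = fourierCoeff g k := by
  unfold fourierCoeff
  rw [← integral_neg_eq_self]
  congr 1
  funext x
  simp [hg, fourier_apply]

/-- Geometric decay of the Fourier coefficients of a function holomorphic in an annulus. -/
lemma norm_fourierCoeff_le {F : ℂ → ℂ} {ρ M : ℝ} (hρ : 1 < ρ)
    (hF : ∀ z : ℂ, 1 ≤ ‖z‖ → ‖z‖ ≤ ρ → DifferentiableAt ℂ F z)
    (hM : ∀ z : ℂ, ‖z‖ = ρ → ‖F z‖ ≤ M) (k : ℕ) :
    ‖fourierCoeff (fun x : AddCircle (2 * Real.pi) => F (x.toCircle : ℂ)) k‖ ≤ M * ρ⁻¹ ^ k := by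
  have hd : ∀ z : ℂ, 1 ≤ ‖z‖ → ‖z‖ ≤ ρ →
      DifferentiableAt ℂ (fun z => (z ^ (k + 1))⁻¹ * F z) z := by
    intro z h1 h2
    have hz : z ≠ 0 := by
      rintro rfl
      simp at h1
      linarith
    exact (((differentiableAt_id.pow (k + 1))).inv (pow_ne_zero _ hz)).mul (hF z h1 h2)
  -- Cauchy's theorem in the annulus moves the contour from the unit circle to radius `ρ`, where `z
  -- ^ -(k + 1)` is small.
  rw [fourierCoeff_eq_circleIntegral,
    ← Complex.circleIntegral_eq_of_differentiable_on_annulus_off_countable one_pos hρ.le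
      Set.countable_empty]
  · refine (circleIntegral.norm_two_pi_i_inv_smul_integral_le_of_norm_le_const
      (C := ρ⁻¹ ^ (k + 1) * M) (by linarith) ?_).trans (le_of_eq ?_)
    · intro z hz
      have hz' : ‖z‖ = ρ := by simpa using hz
      rw [norm_mul, norm_inv, norm_pow, hz', inv_pow]
      gcongr
      exact hM z hz'
    · have : ρ ≠ 0 := by linarith
      calc ρ * (ρ⁻¹ ^ (k + 1) * M) = (ρ * ρ⁻¹) * (M * ρ⁻¹ ^ k) := by ring
        _ = M * ρ⁻¹ ^ k := by rw [mul_inv_cancel₀ this, one_mul]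
  · intro z hz
    simp only [Set.mem_sdiff, mem_closedBall_zero_iff, mem_ball_zero_iff, not_lt] at hz
    exact (hd z hz.2 hz.1).continuousAt.continuousWithinAt
  · intro z hz
    simp only [Set.mem_sdiff, mem_closedBall_zero_iff, mem_ball_zero_iff, not_le] at hz
    exact hd z hz.1.2.le hz.1.1.le

/-- A function that is holomorphic on the closed Bernstein ellipse of parameter `ρ` and bounded by
`M` on its boundary is approximated on `[-1, 1]` by its truncated Chebyshev expansion up to
`2 M ρ^{-m} / (1 - ρ⁻¹)`. -/
theorem exists_chebyshev_approximation {f : ℂ → ℂ} {ρ M : ℝ} (hρ : 1 < ρ)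
    (hf : ∀ z : ℂ, 1 ≤ ‖z‖ → ‖z‖ ≤ ρ → DifferentiableAt ℂ f (joukowski z))
    (hM : ∀ z : ℂ, ‖z‖ = ρ → ‖f (joukowski z)‖ ≤ M) {m : ℕ} (hm : 1 ≤ m) :
    ∃ c : ℕ → ℂ, ∀ y ∈ Set.Icc (-1 : ℝ) 1,
      ‖f y - ∑ k ∈ Finset.range m, c k * ((Polynomial.Chebyshev.T ℝ k).eval y : ℝ)‖ ≤
        2 * M * ρ⁻¹ ^ m * (1 - ρ⁻¹)⁻¹ := by
  set F : ℂ → ℂ := fun z => f (joukowski z) with hFdef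
  have hF : ∀ z : ℂ, 1 ≤ ‖z‖ → ‖z‖ ≤ ρ → DifferentiableAt ℂ F z := by
    intro z h1 h2
    have hz : z ≠ 0 := by
      rintro rfl
      simp at h1
      linarith
    exact (hf z h1 h2).comp z (differentiableAt_joukowski hz)
  have hq0 : 0 < ρ⁻¹ := by positivity
  have hq1 : ρ⁻¹ < 1 := inv_lt_one_of_one_lt₀ hρ
  let G : C(AddCircle (2 * Real.pi), ℂ) :=
    ⟨fun x => F (x.toCircle : ℂ), by
      rw [continuous_iff_continuousAt]
      intro x
      have h1 : ContinuousAt F (x.toCircle : ℂ) :=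
        (hF _ (Circle.norm_coe _).ge ((Circle.norm_coe _).le.trans hρ.le)).continuousAt
      exact h1.comp (f := fun x : AddCircle (2 * Real.pi) => (x.toCircle : ℂ))
        (continuous_subtype_val.comp AddCircle.continuous_toCircle).continuousAt⟩
  -- The Joukowski map is invariant under `z ↦ z⁻¹`, so the Fourier series on the circle is a cosine
  -- series, which at `θ = arccos y` is the Chebyshev series of `f`.
  have hGe : ∀ x, G (-x) = G x := by
    intro x
    simp only [G, ContinuousMap.coe_mk, hFdef, AddCircle.toCircle_neg, Circle.coe_inv,
      joukowski_inv]
  set a : ℤ → ℂ := fourierCoeff G with ha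
  have hneg : ∀ k, a (-k) = a k := fourierCoeff_neg_of_even hGe
  have hbd : ∀ k : ℕ, ‖a k‖ ≤ M * ρ⁻¹ ^ k := norm_fourierCoeff_le hρ hF hM
  have hgeo : Summable fun k : ℕ => M * ρ⁻¹ ^ k :=
    (summable_geometric_of_lt_one hq0.le hq1).mul_left M
  have hsum : Summable a := by
    refine Summable.of_nat_of_neg ?_ ?_
    · exact Summable.of_norm_bounded hgeo hbd
    · refine Summable.of_norm_bounded hgeo fun k => ?_
      rw [hneg]
      exact hbd k
  refine ⟨fun k => if k = 0 then a 0 else 2 * a k, fun y hy => ?_⟩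
  set θ := Real.arccos y
  have hcos : Real.cos θ = y := Real.cos_arccos hy.1 hy.2
  have hS := (has_pointwise_sum_fourier_series_of_summable hsum
    (θ : AddCircle (2 * Real.pi))).nat_add_neg
  have hπ : (Real.pi : ℂ) ≠ 0 := by exact_mod_cast Real.pi_ne_zero
  have hGy : G (θ : AddCircle (2 * Real.pi)) = f y := by
    simp only [G, ContinuousMap.coe_mk, hFdef]
    rw [AddCircle.toCircle_apply_mk, Circle.coe_exp, ← hcos, ← joukowski_exp]
    congr 3
    push_cast
    field_simp
  have hterm : ∀ k : ℕ, (fourierCoeff G k • fourier k (θ : AddCircle (2 * Real.pi)) +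
      fourierCoeff G (-(k : ℤ)) • fourier (-(k : ℤ)) (θ : AddCircle (2 * Real.pi)) : ℂ) =
      2 * a k * ((Polynomial.Chebyshev.T ℝ k).eval y : ℝ) := by
    intro k
    rw [← ha, hneg, fourier_coe_apply, fourier_coe_apply, ← hcos,
      Polynomial.Chebyshev.T_real_cos, Complex.ofReal_cos, Complex.cos, smul_eq_mul, smul_eq_mul,
      ← mul_add]
    have e1 : (2 * Real.pi * Complex.I * ((k : ℤ) : ℂ) * θ / ((2 * Real.pi : ℝ) : ℂ)) =
        ((((k : ℤ) : ℝ) * θ : ℝ) : ℂ) * Complex.I := by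
      push_cast
      field_simp
    have e2 : (2 * Real.pi * Complex.I * ((-(k : ℤ) : ℤ) : ℂ) * θ / ((2 * Real.pi : ℝ) : ℂ)) =
        -((((k : ℤ) : ℝ) * θ : ℝ) : ℂ) * Complex.I := by
      push_cast
      field_simp
    rw [e1, e2]
    ring
  simp only [hterm] at hS
  rw [hGy] at hS
  have hzero : (fourierCoeff G 0 • fourier 0 (θ : AddCircle (2 * Real.pi)) : ℂ) = a 0 := by
    simp [ha]
  rw [hzero, ← hasSum_nat_add_iff' m] at hS
  have hbound := hS.norm_le_of_bounded
    ((hasSum_geometric_of_lt_one hq0.le hq1).mul_left (2 * M * ρ⁻¹ ^ m)) (fun k => by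
      rw [norm_mul, norm_mul, Complex.norm_ofNat, Complex.norm_real, Real.norm_eq_abs]
      have hT := Polynomial.Chebyshev.abs_eval_T_real_le_one ((k + m : ℕ) : ℤ) (abs_le.2 hy)
      have hb := hbd (k + m)
      rw [pow_add] at hb
      calc 2 * ‖a ((k + m : ℕ) : ℤ)‖ * |(Polynomial.Chebyshev.T ℝ ((k + m : ℕ) : ℤ)).eval y|
          ≤ 2 * ‖a ((k + m : ℕ) : ℤ)‖ * 1 := by gcongr
        _ ≤ _ := by linarith)
  refine le_of_eq_of_le (congrArg norm ?_) hbound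
  -- Pairing `k` with `-k` counts the constant term twice. As `m ≥ 1`, that term lies in the removed
  -- partial sum and the surplus `a 0` cancels.
  obtain ⟨m, rfl⟩ := Nat.exists_eq_add_of_le' hm
  rw [Finset.sum_range_succ', Finset.sum_range_succ']
  simp
  ring

/-! ### Gauss rules -/

lemma jacobiWeight_nonneg (y : ℝ) (hy : y ∈ Set.Icc (-1 : ℝ) 1) : 0 ≤ jacobiWeight y :=
  Real.rpow_nonneg (by linarith [hy.1]) _

lemma intervalIntegrable_jacobiWeight : IntervalIntegrable jacobiWeight volume (-1) 1 := by
  have h := (intervalIntegral.intervalIntegrable_rpow' (a := 0) (b := 2) (r := -(1 / 2))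
    (by norm_num)).comp_add_left 1
  norm_num at h
  unfold jacobiWeight
  norm_num
  exact h

lemma integral_jacobiWeight : ∫ y in (-1 : ℝ)..1, jacobiWeight y = 2 * Real.sqrt 2 := by
  unfold jacobiWeight
  rw [intervalIntegral.integral_comp_add_left (fun x : ℝ => x ^ (-(1 / 2) : ℝ)) 1,
    integral_rpow (Or.inl (by norm_num)), Real.sqrt_eq_rpow]
  norm_num
  ring

lemma jacobiWeight_mul_sqrt {y : ℝ} (hy : -1 < y) : jacobiWeight y * Real.sqrt (1 + y) = 1 := by
  rw [jacobiWeight, Real.sqrt_eq_rpow, ← Real.rpow_add (by linarith)]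
  norm_num

namespace IsGaussRule

variable {w : ℝ → ℝ} {Q : ℕ} {node weight : Fin Q → ℝ}

/-- The squared product of the factors `y - node k` over `k ≠ j` has degree `2Q - 2`, so the rule is
exact for it; it vanishes at every node but `j` and has nonnegative integral. -/
lemma weight_nonneg (hG : IsGaussRule w Q node weight)
    (hw : ∀ y ∈ Set.Icc (-1 : ℝ) 1, 0 ≤ w y) (j : Fin Q) : 0 ≤ weight j := by
  classical
  set p : Polynomial ℝ :=
    (∏ k ∈ Finset.univ.erase j, (Polynomial.X - Polynomial.C (node k))) ^ 2 with hp
  have heval : ∀ y, p.eval y = (∏ k ∈ Finset.univ.erase j, (y - node k)) ^ 2 := by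
    intro y
    simp [hp, Polynomial.eval_prod]
  have hdeg : p.natDegree < 2 * Q := by
    have hQ : 0 < Q := j.pos
    have h1 : (∏ k ∈ Finset.univ.erase j,
        (Polynomial.X - Polynomial.C (node k))).natDegree = Q - 1 := by
      rw [Polynomial.natDegree_prod_of_monic _ _ fun k _ => Polynomial.monic_X_sub_C _]
      simp
    rw [hp, Polynomial.natDegree_pow, h1]
    omega
  have h := hG.exact p hdeg
  rw [Finset.sum_eq_single j] at h
  · have hpos : 0 < p.eval (node j) := by
      rw [heval]
      refine sq_pos_of_ne_zero ?_
      exact Finset.prod_ne_zero_iff.2 fun k hk =>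
        sub_ne_zero.2 fun e => (Finset.ne_of_mem_erase hk) (hG.injective e).symm
    have hint : 0 ≤ ∫ y in (-1 : ℝ)..1, w y * p.eval y :=
      intervalIntegral.integral_nonneg (by norm_num) fun y hy =>
        mul_nonneg (hw y hy) (by rw [heval]; positivity)
    rw [← h] at hint
    exact nonneg_of_mul_nonneg_left hint hpos
  · intro k _ hkj
    rw [heval, Finset.prod_eq_zero (i := k)]
    · simp
    · simp [hkj]
    · simp
  · simp

lemma sum_weight (hG : IsGaussRule w Q node weight) (hQ : 1 ≤ Q) :
    ∑ j, weight j = ∫ y in (-1 : ℝ)..1, w y := by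
  simpa using hG.exact 1 (by simp; omega)

/-- The error of a Gauss rule is controlled by the uniform error of polynomial approximation. -/
theorem norm_error_le (hG : IsGaussRule w Q node weight) (hQ : 1 ≤ Q)
    (hw : ∀ y ∈ Set.Icc (-1 : ℝ) 1, 0 ≤ w y) (hwi : IntervalIntegrable w volume (-1) 1)
    {f : ℝ → ℂ} (hf : ContinuousOn f (Set.Icc (-1) 1)) {c : ℕ → ℂ} {p : ℕ → Polynomial ℝ}
    (hp : ∀ k < 2 * Q, (p k).natDegree < 2 * Q) {ε : ℝ}
    (hε : ∀ y ∈ Set.Icc (-1 : ℝ) 1,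
      ‖f y - ∑ k ∈ Finset.range (2 * Q), c k * ((p k).eval y : ℝ)‖ ≤ ε) :
    ‖(∫ y in (-1 : ℝ)..1, (w y : ℂ) * f y) - ∑ j, (weight j : ℂ) * f (node j)‖ ≤
      2 * ε * ∫ y in (-1 : ℝ)..1, w y := by
  set P : ℝ → ℂ := fun y => ∑ k ∈ Finset.range (2 * Q), c k * ((p k).eval y : ℝ) with hP
  have hPc : Continuous P := by
    refine continuous_finsetSum _ fun k _ => continuous_const.mul ?_
    exact Complex.continuous_ofReal.comp (p k).continuous
  have hwC : IntervalIntegrable (fun y => (w y : ℂ)) volume (-1) 1 :=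
    ⟨hwi.1.ofReal, hwi.2.ofReal⟩
  have hu : Set.uIcc (-1 : ℝ) 1 = Set.Icc (-1) 1 := Set.uIcc_of_le (by norm_num)
  have hfi : IntervalIntegrable (fun y => (w y : ℂ) * f y) volume (-1) 1 :=
    hwC.mul_continuousOn (by rwa [hu])
  have hPi : IntervalIntegrable (fun y => (w y : ℂ) * P y) volume (-1) 1 :=
    hwC.mul_continuousOn hPc.continuousOn
  have hexact : ∫ y in (-1 : ℝ)..1, (w y : ℂ) * P y = ∑ j, (weight j : ℂ) * P (node j) := by
    have h1 : ∀ y, (w y : ℂ) * P y =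
        ∑ k ∈ Finset.range (2 * Q), c k * ((w y * (p k).eval y : ℝ) : ℂ) := by
      intro y
      rw [hP, Finset.mul_sum]
      refine Finset.sum_congr rfl fun k _ => ?_
      push_cast
      ring
    simp_rw [h1]
    rw [intervalIntegral.integral_finsetSum]
    · simp_rw [intervalIntegral.integral_const_mul, intervalIntegral.integral_ofReal]
      simp_rw [hP, Finset.mul_sum]
      rw [Finset.sum_comm]
      refine Finset.sum_congr rfl fun k hk => ?_
      rw [← hG.exact (p k) (hp k (Finset.mem_range.1 hk)), Complex.ofReal_sum, Finset.mul_sum]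
      refine Finset.sum_congr rfl fun j _ => ?_
      push_cast
      ring
    · intro k _
      have := hwi.mul_continuousOn (p k).continuous.continuousOn
      exact IntervalIntegrable.const_mul ⟨this.1.ofReal, this.2.ofReal⟩ _
  -- Exactness lets `P` be subtracted from `f` in both terms; each remainder is then at most `ε ∫
  -- w`, the weights being nonnegative with sum `∫ w`.
  have hsplit : (∫ y in (-1 : ℝ)..1, (w y : ℂ) * f y) - ∑ j, (weight j : ℂ) * f (node j) =
      (∫ y in (-1 : ℝ)..1, (w y : ℂ) * (f y - P y)) -
        ∑ j, (weight j : ℂ) * (f (node j) - P (node j)) := by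
    simp_rw [mul_sub]
    rw [intervalIntegral.integral_sub hfi hPi, Finset.sum_sub_distrib, hexact]
    ring
  have hI : ‖∫ y in (-1 : ℝ)..1, (w y : ℂ) * (f y - P y)‖ ≤ ε * ∫ y in (-1 : ℝ)..1, w y := by
    rw [← intervalIntegral.integral_const_mul]
    refine intervalIntegral.norm_integral_le_of_norm_le (by norm_num) ?_ (hwi.const_mul ε)
    refine Filter.Eventually.of_forall fun y hy => ?_
    have hy' : y ∈ Set.Icc (-1 : ℝ) 1 := Set.Ioc_subset_Icc_self hy
    rw [norm_mul, Complex.norm_real, Real.norm_of_nonneg (hw y hy'), mul_comm]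
    exact mul_le_mul_of_nonneg_right (hε y hy') (hw y hy')
  have hS : ‖∑ j, (weight j : ℂ) * (f (node j) - P (node j))‖ ≤
      ε * ∫ y in (-1 : ℝ)..1, w y := by
    rw [← hG.sum_weight hQ, Finset.mul_sum]
    refine norm_sum_le_of_le _ fun j _ => ?_
    have hj := hG.weight_nonneg hw j
    rw [norm_mul, Complex.norm_real, Real.norm_of_nonneg hj, mul_comm]
    exact mul_le_mul_of_nonneg_right (hε _ (Set.Ioo_subset_Icc_self (hG.mem_Ioo j))) hj
  rw [hsplit]
  refine (norm_sub_le _ _).trans ?_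
  linarith

/-- The error of a Gauss rule for a function that is holomorphic on the closed Bernstein ellipse
of parameter `ρ` and bounded by `M` on its boundary. -/
theorem norm_error_le_of_differentiableAt (hG : IsGaussRule w Q node weight) (hQ : 1 ≤ Q)
    (hw : ∀ y ∈ Set.Icc (-1 : ℝ) 1, 0 ≤ w y) (hwi : IntervalIntegrable w volume (-1) 1)
    {f : ℂ → ℂ} {ρ M : ℝ} (hρ : 1 < ρ)
    (hf : ∀ z : ℂ, 1 ≤ ‖z‖ → ‖z‖ ≤ ρ → DifferentiableAt ℂ f (joukowski z))
    (hM : ∀ z : ℂ, ‖z‖ = ρ → ‖f (joukowski z)‖ ≤ M) :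
    ‖(∫ y in (-1 : ℝ)..1, (w y : ℂ) * f y) - ∑ j, (weight j : ℂ) * f (node j)‖ ≤
      2 * (2 * M * ρ⁻¹ ^ (2 * Q) * (1 - ρ⁻¹)⁻¹) * ∫ y in (-1 : ℝ)..1, w y := by
  obtain ⟨c, hc⟩ := exists_chebyshev_approximation hρ hf hM (m := 2 * Q) (by omega)
  refine hG.norm_error_le hQ hw hwi (f := fun y : ℝ => f y) ?_ (fun k hk => ?_) hc
  · intro y hy
    have h1 := hf (Complex.exp (Real.arccos y * Complex.I)) (by simp [Complex.norm_exp])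
      (by simp [Complex.norm_exp, hρ.le])
    rw [joukowski_exp, Real.cos_arccos hy.1 hy.2] at h1
    exact (h1.continuousAt.comp (f := fun y : ℝ => (y : ℂ))
      Complex.continuous_ofReal.continuousAt).continuousWithinAt
  · rw [Polynomial.Chebyshev.natDegree_T]
    simpa using hk

end IsGaussRule

/-! ### The vectors `e_n` of a stiffly accurate method -/

section RungeKutta

variable {s : ℕ} {A : Matrix (Fin (s + 1)) (Fin (s + 1)) ℝ} {b : Fin (s + 1) → ℝ}

/-- Multiplying the stiff accuracy identity by `A` on the right shows that `bᵀ` is the last row of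
`A`. -/
lemma RungeKuttaAssumption.single_vecMul (hRK : RungeKuttaAssumption A b) :
    (Pi.single (Fin.last s) 1 : Fin (s + 1) → ℂ) ᵥ* complexMatrix A = complexVector b := by
  have h : (Pi.single (Fin.last s) 1 : Fin (s + 1) → ℝ) ᵥ* A = b := by
    rw [← hRK.stifflyAccurate, vecMul_vecMul, nonsing_inv_mul _ ((isUnit_iff_isUnit_det _).1
      hRK.invertible), vecMul_one]
  funext j
  have hj := congrFun h j
  rw [single_one_vecMul] at hj ⊢
  simp only [complexMatrix, complexVector, row_apply, map_apply] at hj ⊢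
  rw [hj]

lemma isUnit_complexMatrix (hA : IsUnit A) : IsUnit (complexMatrix A) :=
  hA.map (Complex.ofRealHom.mapMatrix (m := Fin (s + 1)))

lemma qVector_vecMul {z : ℂ} (hz : IsUnit (1 - z • complexMatrix A)) :
    qVector A b z ᵥ* (1 - z • complexMatrix A) = complexVector b := by
  rw [qVector, vecMul_vecMul, nonsing_inv_mul _ ((isUnit_iff_isUnit_det _).1 hz), vecMul_one]

lemma stabilityFunction_eq (z : ℂ) :
    stabilityFunction A b z = 1 + z * (qVector A b z ⬝ᵥ 1) := by
  rw [stabilityFunction, qVector, dotProduct_mulVec]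

/-- The matrix `A + ζ / (1 - ζ) 𝟙 bᵀ`, whose inverse is the symbol. -/
def invSymbol (A : Matrix (Fin (s + 1)) (Fin (s + 1)) ℝ) (b : Fin (s + 1) → ℝ) :
    Matrix (Fin (s + 1)) (Fin (s + 1)) (PowerSeries ℂ) :=
  (complexMatrix A).map (fun a => PowerSeries.C a)
    + ((PowerSeries.X : PowerSeries ℂ) * (1 - PowerSeries.X)⁻¹) •
      (vecMulVec (1 : Fin (s + 1) → ℂ) (complexVector b)).map (fun a => PowerSeries.C a)

lemma isUnit_of_constantCoeff {M : Matrix (Fin (s + 1)) (Fin (s + 1)) (PowerSeries ℂ)}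
    (h : IsUnit (M.map (PowerSeries.constantCoeff (R := ℂ)))) : IsUnit M := by
  rw [isUnit_iff_isUnit_det] at h ⊢
  rw [PowerSeries.isUnit_iff_constantCoeff, RingHom.map_det]
  exact h

lemma constantCoeff_invSymbol :
    (invSymbol A b).map (PowerSeries.constantCoeff (R := ℂ)) = complexMatrix A := by
  ext i j
  simp [invSymbol]

lemma constantCoeff_one_sub (z : ℂ) :
    (1 - (PowerSeries.C z : PowerSeries ℂ) • invSymbol A b).map
      (PowerSeries.constantCoeff (R := ℂ)) = 1 - z • complexMatrix A := by
  ext i j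
  have := congrFun (congrFun (constantCoeff_invSymbol (A := A) (b := b)) i) j
  simp only [map_apply] at this
  simp [this, one_apply, apply_ite]

/-- `(1 - r ζ) e = q` for the generating function of `e_n = r ^ n q`. -/
lemma invSymbol_vecMul (hRK : RungeKuttaAssumption A b) {z : ℂ}
    (hz : IsUnit (1 - z • complexMatrix A)) :
    (fun j => PowerSeries.C (qVector A b z j)) ᵥ*
        (1 - (PowerSeries.C z : PowerSeries ℂ) • invSymbol A b) =
      (1 - PowerSeries.C (stabilityFunction A b z) * PowerSeries.X : PowerSeries ℂ) •
        ((Pi.single (Fin.last s) 1 : Fin (s + 1) → PowerSeries ℂ) ᵥ* invSymbol A b) := by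
  have hq := qVector_vecMul (b := b) hz
  have hs := hRK.single_vecMul
  have hX : (1 - PowerSeries.X : PowerSeries ℂ) * (1 - PowerSeries.X)⁻¹ = 1 :=
    PowerSeries.mul_inv_cancel _ (by simp)
  set u : PowerSeries ℂ := (1 - PowerSeries.X)⁻¹
  rw [vecMul_sub, vecMul_one, vecMul_smul] at hq ⊢
  funext j
  have hqj := congrArg (PowerSeries.C (R := ℂ)) (congrFun hq j)
  have hsj := congrFun hs j
  rw [single_one_vecMul, row_apply] at hsj
  rw [stabilityFunction_eq, Pi.smul_apply, single_one_vecMul, row_apply]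
  have hM : ∀ i, invSymbol A b i j = PowerSeries.C (complexMatrix A i j) +
      PowerSeries.X * u * PowerSeries.C (complexVector b j) := fun i => by
    simp [invSymbol, u]
  simp only [Pi.sub_apply, Pi.smul_apply, vecMul, dotProduct, hM, hsj, smul_eq_mul, mul_add,
    Finset.sum_add_distrib, map_sub, map_mul, map_sum,
    map_add, map_one, Pi.one_apply, mul_one, ← Finset.sum_mul] at hqj ⊢
  -- Both sides are multiples of `b j`; they agree because `1 + ζ / (1 - ζ) = 1 / (1 - ζ)` and `r =
  -- 1 + z q 𝟙`.
  linear_combination hqj - PowerSeries.C (complexVector b j) * PowerSeries.X *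
    (1 + PowerSeries.C z * ∑ i, PowerSeries.C (qVector A b z i)) * hX

/-- With `M` the inverse of the symbol `Δ`, `(Δ - z) M = 1 - z M`. Cancelling `M` in
`invSymbol_vecMul` turns it into `q = (1 - r ζ) e`, where `e` is the last row of `(Δ - z)⁻¹`, so the
coefficients of `e` form a geometric sequence. -/
theorem eVector_eq (hRK : RungeKuttaAssumption A b) {z : ℂ}
    (hz : IsUnit (1 - z • complexMatrix A)) (n : ℕ) :
    eVector A b n z = stabilityFunction A b z ^ n • qVector A b z := by
  set r := stabilityFunction A b z
  have hM : IsUnit (invSymbol A b) :=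
    isUnit_of_constantCoeff (by rw [constantCoeff_invSymbol]
                                exact isUnit_complexMatrix hRK.invertible)
  have hMdet := (isUnit_iff_isUnit_det _).1 hM
  have hN : IsUnit (1 - (PowerSeries.C z : PowerSeries ℂ) • invSymbol A b) :=
    isUnit_of_constantCoeff (by rwa [constantCoeff_one_sub])
  set D : Matrix (Fin (s + 1)) (Fin (s + 1)) (PowerSeries ℂ) :=
    symbol A b - (PowerSeries.C z : PowerSeries ℂ) • 1 with hDdef
  have hDM : D * invSymbol A b = 1 - (PowerSeries.C z : PowerSeries ℂ) • invSymbol A b := by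
    rw [hDdef, sub_mul, smul_mul_assoc, one_mul]
    congr 1
    exact nonsing_inv_mul _ hMdet
  have hD : IsUnit D := by
    rw [← hDM] at hN
    rw [isUnit_iff_isUnit_det] at hN ⊢
    rw [det_mul] at hN
    exact isUnit_of_mul_isUnit_left hN
  have hDdet := (isUnit_iff_isUnit_det _).1 hD
  set e : Fin (s + 1) → PowerSeries ℂ := Pi.single (Fin.last s) 1
  have h1 : (fun j => PowerSeries.C (qVector A b z j)) ᵥ* D =
      (1 - PowerSeries.C r * PowerSeries.X : PowerSeries ℂ) • e := by
    have h := invSymbol_vecMul hRK hz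
    rw [← hDM, ← vecMul_vecMul, ← smul_vecMul] at h
    have h' := congrArg (fun v => v ᵥ* (invSymbol A b)⁻¹) h
    simpa only [vecMul_vecMul, mul_assoc, mul_nonsing_inv _ hMdet, mul_one, vecMul_one] using h'
  have h2 : (fun j => PowerSeries.C (qVector A b z j)) =
      (1 - PowerSeries.C r * PowerSeries.X : PowerSeries ℂ) • (e ᵥ* D⁻¹) := by
    have h' := congrArg (fun v => v ᵥ* D⁻¹) h1
    simpa only [vecMul_vecMul, mul_nonsing_inv _ hDdet, vecMul_one, smul_vecMul] using h'
  funext j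
  have h3 : PowerSeries.C (qVector A b z j) =
      (1 - PowerSeries.C r * PowerSeries.X : PowerSeries ℂ) * D⁻¹ (Fin.last s) j := by
    simpa [e, single_one_vecMul] using congrFun h2 j
  change PowerSeries.coeff n (D⁻¹ (Fin.last s) j) = r ^ n * qVector A b z j
  induction n with
  | zero =>
    have := congrArg (PowerSeries.coeff 0) h3
    simpa [sub_mul, mul_assoc] using this.symm
  | succ n ih =>
    have := congrArg (PowerSeries.coeff (n + 1)) h3
    rw [sub_mul, one_mul, mul_assoc, map_sub, PowerSeries.coeff_C_mul,
      PowerSeries.coeff_succ_X_mul, ih, PowerSeries.coeff_C] at this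
    simp only [Nat.succ_ne_zero, if_false] at this
    linear_combination -this

/-! ### Holomorphy of `q` and `r` -/

lemma differentiableAt_det {m : ℕ} {M : ℂ → Matrix (Fin m) (Fin m) ℂ} {z : ℂ}
    (hM : ∀ i j, DifferentiableAt ℂ (fun z => M z i j) z) :
    DifferentiableAt ℂ (fun z => (M z).det) z := by
  simp only [det_apply']
  refine DifferentiableAt.fun_sum fun σ _ => (differentiableAt_const _).mul ?_
  exact DifferentiableAt.fun_finsetProd fun i _ => hM _ _

/-- By Cramer's rule the entries of the inverse are quotients of determinants. -/
lemma differentiableAt_inv_apply {m : ℕ} {M : ℂ → Matrix (Fin m) (Fin m) ℂ} {z : ℂ}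
    (hM : ∀ i j, DifferentiableAt ℂ (fun z => M z i j) z) (hz : IsUnit (M z)) (i j : Fin m) :
    DifferentiableAt ℂ (fun z => (M z)⁻¹ i j) z := by
  have hdet : (M z).det ≠ 0 := ((isUnit_iff_isUnit_det _).1 hz).ne_zero
  simp only [inv_def, Ring.inverse_eq_inv', Matrix.smul_apply, smul_eq_mul, adjugate_apply]
  refine ((differentiableAt_det hM).inv hdet).mul (differentiableAt_det fun k l => ?_)
  by_cases h : k = j
  · subst h
    simp
  · simpa [updateRow_apply, h] using hM k l

lemma differentiableAt_qVector {z : ℂ} (hz : IsUnit (1 - z • complexMatrix A))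
    (j : Fin (s + 1)) : DifferentiableAt ℂ (fun z => qVector A b z j) z := by
  simp only [qVector, vecMul, dotProduct]
  refine DifferentiableAt.fun_sum fun i _ => (differentiableAt_const _).mul ?_
  refine differentiableAt_inv_apply (fun k l => ?_) hz i j
  simp only [Matrix.sub_apply, Matrix.smul_apply, smul_eq_mul]
  fun_prop

lemma differentiableAt_stabilityFunction {z : ℂ} (hz : IsUnit (1 - z • complexMatrix A)) :
    DifferentiableAt ℂ (stabilityFunction A b) z := by
  have : stabilityFunction A b = fun z => 1 + z * ∑ j, qVector A b z j := by
    funext z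
    simp [stabilityFunction_eq, dotProduct]
  rw [this]
  exact (differentiableAt_const _).add
    (differentiableAt_id.mul (DifferentiableAt.fun_sum fun j _ => differentiableAt_qVector hz j))

end RungeKutta

/-! ### The even entire function `cosh √u` -/

/-- The entire function `u ↦ cosh √u`. -/
def coshSqrt (u : ℂ) : ℂ := ∑' k : ℕ, u ^ k / ((2 * k).factorial : ℂ)

lemma coshSqrt_sq (w : ℂ) : coshSqrt (w ^ 2) = Complex.cosh w := by
  rw [Complex.cosh_eq_tsum, coshSqrt]
  simp_rw [pow_mul]

lemma differentiable_coshSqrt : Differentiable ℂ coshSqrt := by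
  intro z
  have h : DifferentiableOn ℂ coshSqrt (Metric.ball 0 (‖z‖ + 1)) := by
    refine Complex.differentiableOn_tsum_of_summable_norm
      (u := fun k => (‖z‖ + 1) ^ k / (k.factorial : ℝ)) (Real.summable_pow_div_factorial _)
      (fun k => by fun_prop) Metric.isOpen_ball fun k w hw => ?_
    rw [norm_div, norm_pow, Complex.norm_natCast]
    rw [mem_ball_zero_iff] at hw
    gcongr
    omega
  exact (h z (by simp)).differentiableAt (Metric.isOpen_ball.mem_nhds (by simp))

lemma norm_coshSqrt_le (u : ℂ) : ‖coshSqrt u‖ ≤ Real.exp (Real.sqrt ‖u‖) := by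
  obtain ⟨w, rfl⟩ := IsAlgClosed.exists_pow_nat_eq u (n := 2) (by norm_num)
  rw [coshSqrt_sq, norm_pow, Real.sqrt_sq (norm_nonneg _), Complex.cosh, norm_div,
    Complex.norm_ofNat]
  have h1 := Complex.norm_exp_le_exp_norm w
  have h2 := Complex.norm_exp_le_exp_norm (-w)
  rw [norm_neg] at h2
  have h3 := norm_add_le (Complex.exp w) (Complex.exp (-w))
  linarith

lemma jumpG_eq (lam x : ℝ) (hlam : 0 ≤ lam) :
    jumpG lam x = -(1 / ((Real.sqrt lam : ℂ) * Complex.exp (Real.pi / 4 * Complex.I))) *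
      coshSqrt (Complex.I * x ^ 2 * lam) := by
  set σ : ℂ := (Real.sqrt lam : ℂ) * Complex.exp (Real.pi / 4 * Complex.I) with hσ
  have e1 : Complex.exp (-(Complex.I * Real.pi / 4)) *
      ((Real.sqrt lam : ℂ) * Complex.exp (Complex.I * (Real.pi : ℝ) / 2)) = σ := by
    rw [hσ, mul_left_comm, ← Complex.exp_add]
    ring_nf
  have e2 : Complex.exp (-(Complex.I * Real.pi / 4)) *
      ((Real.sqrt lam : ℂ) * Complex.exp (Complex.I * (-Real.pi : ℝ) / 2)) = -σ := by
    have e : -(Complex.I * Real.pi / 4) + Complex.I * (-Real.pi : ℝ) / 2 =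
        Real.pi / 4 * Complex.I - Real.pi * Complex.I := by
      push_cast
      ring
    rw [hσ, mul_left_comm, ← Complex.exp_add, e, Complex.exp_sub, Complex.exp_pi_mul_I]
    ring
  have e3 : Complex.I * x ^ 2 * lam = (((|x| : ℝ) : ℂ) * σ) ^ 2 := by
    have h1 : (Real.sqrt lam : ℂ) ^ 2 = lam := by
      exact_mod_cast Real.sq_sqrt hlam
    have h2 : Complex.exp (Real.pi / 4 * Complex.I) ^ 2 = Complex.I := by
      have e : ((2 : ℕ) : ℂ) * (Real.pi / 4 * Complex.I) = Real.pi / 2 * Complex.I := by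
        push_cast
        ring
      rw [← Complex.exp_nat_mul, e, Complex.exp_pi_div_two_mul_I]
    have h3 : ((|x| : ℝ) : ℂ) ^ 2 = (x : ℂ) ^ 2 := by
      exact_mod_cast sq_abs x
    rw [hσ, mul_pow, mul_pow, h1, h2, h3]
    ring
  rw [e3, coshSqrt_sq, jumpG, transferK, transferK]
  simp only [e1, e2, Complex.cosh]
  rw [mul_neg, neg_mul_neg, neg_mul, one_div, one_div, one_div, inv_neg, mul_inv]
  ring

/-! ### The holomorphic extension of the integrand -/

section Extension

variable {s : ℕ} {A : Matrix (Fin (s + 1)) (Fin (s + 1)) ℝ} {b : Fin (s + 1) → ℝ}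

/-- The constant factor of the holomorphic extension of `smoothFactor`. -/
def extensionConst (h L₀ : ℝ) : ℂ :=
  -((h : ℂ) * L₀ / (4 * Real.pi * Complex.I) * (Real.sqrt (2 / L₀) : ℂ) *
    Complex.exp (-(Real.pi / 4 * Complex.I)))

lemma norm_extensionConst {h L₀ : ℝ} (hh : 0 < h) (hL : 0 < L₀) :
    ‖extensionConst h L₀‖ = h * L₀ / (4 * Real.pi) * Real.sqrt (2 / L₀) := by
  have h1 : ‖Complex.exp (-(Real.pi / 4 * Complex.I))‖ = 1 := by
    rw [Complex.norm_exp]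
    simp
  rw [extensionConst, norm_neg, norm_mul, h1, mul_one, norm_mul, norm_div, norm_mul, norm_mul,
    norm_mul, Complex.norm_I, Complex.norm_real, Complex.norm_real, Complex.norm_real,
    Complex.norm_real, Real.norm_of_nonneg hh.le, Real.norm_of_nonneg hL.le,
    Real.norm_of_nonneg Real.pi_pos.le, Real.norm_of_nonneg (Real.sqrt_nonneg _), mul_one,
    Complex.norm_ofNat]

/-- The holomorphic extension of `smoothFactor` to the complex plane. -/
def smoothExtension (A : Matrix (Fin (s + 1)) (Fin (s + 1)) ℝ) (b : Fin (s + 1) → ℝ)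
    (h L₀ x : ℝ) (n : ℕ) (z : ℂ) : Fin (s + 1) → ℂ :=
  (extensionConst h L₀ * coshSqrt (Complex.I * x ^ 2 * ((1 + z) * L₀ / 2)) *
      stabilityFunction A b (-(h : ℂ) * ((1 + z) * L₀ / 2)) ^ n) •
    qVector A b (-(h : ℂ) * ((1 + z) * L₀ / 2))

lemma re_argument (h L₀ : ℝ) (z : ℂ) :
    (-(h : ℂ) * ((1 + z) * L₀ / 2)).re = -(h * ((1 + z.re) * L₀ / 2)) := by
  have : -(h : ℂ) * ((1 + z) * L₀ / 2) = ((-(h * L₀ / 2) : ℝ) : ℂ) * (1 + z) := by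
    push_cast
    ring
  rw [this, Complex.re_ofReal_mul]
  simp
  ring

lemma smoothFactor_eq_smoothExtension (hRK : RungeKuttaAssumption A b) {h L₀ : ℝ} (hL : 0 < L₀)
    (x : ℝ) (n : ℕ) {y : ℝ} (hy : -1 < y)
    (hu : IsUnit (1 - (-(h : ℂ) * ((1 + (y : ℂ)) * L₀ / 2)) • complexMatrix A)) :
    smoothFactor A b h L₀ x n y = smoothExtension A b h L₀ x n y := by
  have hy' : 0 < 1 + y := by linarith
  have hsq : Real.sqrt (1 + y) = Real.sqrt (2 / L₀) * Real.sqrt ((1 + y) * L₀ / 2) := by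
    rw [← Real.sqrt_mul (by positivity)]
    congr 1
    field_simp
  have hne : (Real.sqrt ((1 + y) * L₀ / 2) : ℂ) ≠ 0 := by
    exact_mod_cast (Real.sqrt_pos.2 (by positivity)).ne'
  have hexp : Complex.exp (Real.pi / 4 * Complex.I) ≠ 0 := Complex.exp_ne_zero _
  rw [smoothFactor, smoothExtension, eVector_eq hRK hu, smul_smul, jumpG_eq _ _ (by positivity),
    hsq, extensionConst, Complex.exp_neg]
  congr 1
  push_cast
  generalize (Real.sqrt ((1 + y) * L₀ / 2) : ℂ) = v at hne
  field_simp

lemma differentiableAt_smoothExtension {h L₀ x : ℝ} {n : ℕ} {z : ℂ}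
    (hu : IsUnit (1 - (-(h : ℂ) * ((1 + z) * L₀ / 2)) • complexMatrix A)) :
    DifferentiableAt ℂ (smoothExtension A b h L₀ x n) z := by
  have hζ : DifferentiableAt ℂ (fun z : ℂ => -(h : ℂ) * ((1 + z) * L₀ / 2)) z := by fun_prop
  have hc : DifferentiableAt ℂ
      (fun z : ℂ => coshSqrt (Complex.I * x ^ 2 * ((1 + z) * L₀ / 2))) z :=
    (differentiable_coshSqrt _).comp z (by fun_prop)
  have hr : DifferentiableAt ℂ
      (fun z : ℂ => stabilityFunction A b (-(h : ℂ) * ((1 + z) * L₀ / 2))) z :=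
    DifferentiableAt.comp (g := stabilityFunction A b) z
      (differentiableAt_stabilityFunction hu) hζ
  refine differentiableAt_pi.2 fun j => ?_
  have hq : DifferentiableAt ℂ
      (fun z : ℂ => qVector A b (-(h : ℂ) * ((1 + z) * L₀ / 2)) j) z :=
    DifferentiableAt.comp (g := fun z => qVector A b z j) z (differentiableAt_qVector hu j) hζ
  exact (((differentiableAt_const _).mul hc).mul (hr.pow n)).mul hq

/-- The integral `I_{n,0}` as a weighted integral of the holomorphic extension. -/
lemma initialIntegral_eq {h L₀ : ℝ} (hL : 0 < L₀) (x : ℝ) (n : ℕ) :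
    initialIntegral A b h L₀ x n =
      ∫ y in (-1 : ℝ)..1, (jacobiWeight y : ℂ) • smoothFactor A b h L₀ x n y := by
  have hsub := intervalIntegral.integral_comp_mul_add (a := -1) (b := 1)
    (fun lam : ℝ => jumpG lam x • eVector A b n (-(h : ℂ) * lam))
    (c := L₀ / 2) (by positivity) (L₀ / 2)
  have e0 : L₀ / 2 * (-1) + L₀ / 2 = 0 := by ring
  have e1 : L₀ / 2 * 1 + L₀ / 2 = L₀ := by ring
  rw [e0, e1] at hsub
  have hsub' : (∫ lam in (0 : ℝ)..L₀, jumpG lam x • eVector A b n (-(h : ℂ) * lam)) =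
      ((L₀ / 2 : ℝ) : ℂ) • ∫ y in (-1 : ℝ)..1, jumpG (L₀ / 2 * y + L₀ / 2) x •
        eVector A b n (-(h : ℂ) * ((L₀ / 2 * y + L₀ / 2 : ℝ) : ℂ)) := by
    rw [hsub, Complex.coe_smul, smul_smul, mul_inv_cancel₀ (by positivity), one_smul]
  rw [initialIntegral, hsub', smul_smul, ← intervalIntegral.integral_smul]
  refine intervalIntegral.integral_congr_ae (Filter.Eventually.of_forall fun y hy => ?_)
  -- The half-open interval excludes `y = -1`, where weight times `√(1 + y)` is `0` rather than `1`.
  rw [Set.uIoc_of_le (by norm_num)] at hy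
  have hw : (jacobiWeight y : ℂ) * (Real.sqrt (1 + y) : ℂ) = 1 := by
    exact_mod_cast jacobiWeight_mul_sqrt hy.1
  have e2 : L₀ / 2 * y + L₀ / 2 = (1 + y) * L₀ / 2 := by ring
  rw [smoothFactor, smul_smul, smul_smul, e2]
  push_cast
  congr 1
  linear_combination (-(h : ℂ) * L₀ / (4 * Real.pi * Complex.I) *
    jumpG ((1 + y) * L₀ / 2) x) * hw

end Extension

/-! ### Bounds on Bernstein ellipses -/

/-- Every vector is normed by a linear functional dominated by a given seminorm. -/
lemma exists_dual_eq_seminorm {V : Type*} [AddCommGroup V] [Module ℂ V] (N : Seminorm ℂ V)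
    (v : V) : ∃ φ : V →ₗ[ℂ] ℂ, ‖φ v‖ = N v ∧ ∀ w, ‖φ w‖ ≤ N w := by
  by_cases hv : v = 0
  · exact ⟨0, by simp [hv], fun w => by simp⟩
  -- Hahn–Banach: extend `c v ↦ c N(v)` from the line through `v`.
  · have hc : ∀ w : Submodule.span ℂ {v},
        ‖(((N v : ℝ) : ℂ) • (LinearEquiv.coord ℂ V v hv : Submodule.span ℂ {v} →ₗ[ℂ] ℂ)) w‖ ≤ N w := by
      intro w
      have h := LinearEquiv.coord_apply_smul ℂ V v hv w
      conv_rhs => rw [← h]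
      rw [map_smul_eq_mul, LinearMap.smul_apply, smul_eq_mul, norm_mul, Complex.norm_real,
        Real.norm_of_nonneg (apply_nonneg N v), mul_comm]
      rfl
    obtain ⟨φ, h1, h2⟩ := Module.Dual.exists_extension_of_le_seminorm _ _ hc
    refine ⟨φ, ?_, h2⟩
    have h3 := h1 ⟨v, Submodule.mem_span_singleton_self v⟩
    have h4 : LinearEquiv.coord ℂ V v hv ⟨v, Submodule.mem_span_singleton_self v⟩ = 1 :=
      LinearEquiv.coord_self ℂ V v hv
    rw [LinearMap.smul_apply] at h3
    rw [h3]
    change ‖((N v : ℝ) : ℂ) • LinearEquiv.coord ℂ V v hv _‖ = N v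
    rw [h4, smul_eq_mul, mul_one, Complex.norm_real, Real.norm_of_nonneg (apply_nonneg N v)]

section Bounds

variable {s : ℕ} {A : Matrix (Fin (s + 1)) (Fin (s + 1)) ℝ} {b : Fin (s + 1) → ℝ}
  {N : Seminorm ℂ (Fin (s + 1) → ℂ)} {ν β Cq h L₀ : ℝ}

lemma re_argument_le (hh : 0 < h) (hL : 0 < L₀) {u : ℂ} {a : ℝ} (hu : ‖u‖ ≤ a) :
    (-(h : ℂ) * ((1 + u) * L₀ / 2)).re ≤ h * L₀ / 2 * (a - 1) := by
  rw [re_argument]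
  have h1 : -a ≤ u.re := by
    have := (abs_le.1 ((Complex.abs_re_le_norm u).trans hu)).1
    exact this
  have h2 : 0 < h * L₀ / 2 := by positivity
  nlinarith

/-- A-stability covers the left half-plane and the exponential bound the strip up to `m`; `m ≥ 0`
makes one estimate serve both. -/
lemma norm_stabilityFunction_pow_le (hRK : RungeKuttaAssumption A b)
    (hconst : IsBoundConstants A b N ν β Cq) {z : ℂ} {m : ℝ} (hm : 0 ≤ m) (hmβ : m ≤ β)
    (hz : z.re ≤ m) (n : ℕ) : ‖stabilityFunction A b z ^ n‖ ≤ Real.exp (n * (ν * m)) := by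
  have hν : 0 < ν := by linarith [hconst.one_lt_nu]
  rw [norm_pow, Real.exp_nat_mul]
  refine pow_le_pow_left₀ (norm_nonneg _) ?_ n
  rcases le_total z.re 0 with h0 | h0
  · exact (hRK.aStable z h0).trans (Real.one_le_exp (by positivity))
  · refine (hconst.r_bound z h0 (hz.trans hmβ)).trans (Real.exp_le_exp.2 ?_)
    exact mul_le_mul_of_nonneg_left hz hν.le

/-- For `a ≥ 2`, `1 + a ≤ 3 (a - 1)²`, since the difference is `(3a - 1)(a - 2)`. The square root
thus becomes linear in `a - 1`, like the exponent coming from `r ^ n`; this is the origin of `√(3 L₀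
/ 2)` and of the threshold `2 + √3`. -/
lemma norm_coshSqrt_argument_le (hL : 0 < L₀) (x : ℝ) {u : ℂ} {a : ℝ} (ha : 2 ≤ a)
    (hu : ‖u‖ ≤ a) :
    ‖coshSqrt (Complex.I * x ^ 2 * ((1 + u) * L₀ / 2))‖ ≤
      Real.exp (|x| * Real.sqrt (3 * L₀ / 2) * (a - 1)) := by
  refine (norm_coshSqrt_le _).trans (Real.exp_le_exp.2 ?_)
  have h1 : ‖1 + u‖ ≤ 3 * (a - 1) ^ 2 := by
    have := norm_add_le 1 u
    rw [norm_one] at this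
    nlinarith
  refine Real.sqrt_le_iff.2 ⟨mul_nonneg (by positivity) (by linarith), ?_⟩
  rw [mul_pow, mul_pow, sq_abs, Real.sq_sqrt (by positivity)]
  rw [norm_mul, norm_mul, Complex.norm_I, one_mul, norm_pow, Complex.norm_real, norm_div,
    norm_mul, Complex.norm_real, Real.norm_of_nonneg hL.le, Complex.norm_ofNat, Real.norm_eq_abs,
    sq_abs]
  calc x ^ 2 * (‖1 + u‖ * L₀ / 2) ≤ x ^ 2 * (3 * (a - 1) ^ 2 * L₀ / 2) := by gcongr
    _ = x ^ 2 * (3 * L₀ / 2) * (a - 1) ^ 2 := by ring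

lemma seminorm_smoothExtension_le (hRK : RungeKuttaAssumption A b)
    (hconst : IsBoundConstants A b N ν β Cq) (hh : 0 < h) (hL : 0 < L₀) (x : ℝ) (n : ℕ)
    {u : ℂ} {a : ℝ} (ha : 2 ≤ a) (haβ : h * L₀ / 2 * (a - 1) ≤ β) (hu : ‖u‖ ≤ a) :
    N (smoothExtension A b h L₀ x n u) ≤
      ‖extensionConst h L₀‖ * Cq * Real.exp (growth |x| ν (n * h) L₀ * (a - 1)) := by
  have hre := re_argument_le hh hL hu
  have hm : 0 ≤ h * L₀ / 2 * (a - 1) := mul_nonneg (by positivity) (by linarith)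
  have h1 := norm_coshSqrt_argument_le hL x ha hu
  have h2 := norm_stabilityFunction_pow_le hRK hconst hm haβ hre n
  have h3 := hconst.q_bound _ (hre.trans haβ)
  have hexp : Real.exp (growth |x| ν (n * h) L₀ * (a - 1)) =
      Real.exp (|x| * Real.sqrt (3 * L₀ / 2) * (a - 1)) *
        Real.exp (n * (ν * (h * L₀ / 2 * (a - 1)))) := by
    rw [← Real.exp_add, growth]
    congr 1
    ring
  rw [smoothExtension, map_smul_eq_mul, norm_mul, norm_mul, hexp]
  calc ‖extensionConst h L₀‖ * ‖coshSqrt (Complex.I * x ^ 2 * ((1 + u) * L₀ / 2))‖ *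
        ‖stabilityFunction A b (-(h : ℂ) * ((1 + u) * L₀ / 2)) ^ n‖ *
        N (qVector A b (-(h : ℂ) * ((1 + u) * L₀ / 2)))
      ≤ ‖extensionConst h L₀‖ * Real.exp (|x| * Real.sqrt (3 * L₀ / 2) * (a - 1)) *
        Real.exp (n * (ν * (h * L₀ / 2 * (a - 1)))) * Cq := by gcongr
    _ = _ := by ring

/-- The quadrature error as the error of the Gauss rule for the holomorphic extension, tested
with a linear functional. -/
lemma dual_quadratureError (hRK : RungeKuttaAssumption A b)
    (hconst : IsBoundConstants A b N ν β Cq) (hh : 0 < h) (hL : 0 < L₀) (x : ℝ) (n : ℕ) {Q : ℕ}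
    {node weight : Fin Q → ℝ} (hG : IsGaussRule jacobiWeight Q node weight)
    (φ : (Fin (s + 1) → ℂ) →L[ℂ] ℂ) :
    φ (quadratureError A b h L₀ x n node weight) =
      (∫ y in (-1 : ℝ)..1, (jacobiWeight y : ℂ) * φ (smoothExtension A b h L₀ x n y)) -
        ∑ j, (weight j : ℂ) * φ (smoothExtension A b h L₀ x n (node j)) := by
  have hunit : ∀ y : ℝ, -1 ≤ y →
      IsUnit (1 - (-(h : ℂ) * ((1 + (y : ℂ)) * L₀ / 2)) • complexMatrix A) := by
    intro y hy
    refine hconst.defined _ ?_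
    rw [re_argument, Complex.ofReal_re]
    have : 0 ≤ h * ((1 + y) * L₀ / 2) :=
      mul_nonneg hh.le (div_nonneg (mul_nonneg (by linarith) hL.le) (by norm_num))
    linarith [hconst.beta_pos]
  have hI : initialIntegral A b h L₀ x n =
      ∫ y in (-1 : ℝ)..1, (jacobiWeight y : ℂ) • smoothExtension A b h L₀ x n y := by
    rw [initialIntegral_eq hL]
    refine intervalIntegral.integral_congr_ae (Filter.Eventually.of_forall fun y hy => ?_)
    rw [Set.uIoc_of_le (by norm_num)] at hy
    simp only [smoothFactor_eq_smoothExtension hRK hL x n hy.1 (hunit y hy.1.le)]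
  have hint : IntervalIntegrable
      (fun y : ℝ => (jacobiWeight y : ℂ) • smoothExtension A b h L₀ x n y) volume (-1) 1 := by
    have hw : IntervalIntegrable (fun y => (jacobiWeight y : ℂ)) volume (-1) 1 :=
      ⟨intervalIntegrable_jacobiWeight.1.ofReal, intervalIntegrable_jacobiWeight.2.ofReal⟩
    refine hw.smul_continuousOn ?_
    intro y hy
    rw [Set.uIcc_of_le (by norm_num)] at hy
    exact ((differentiableAt_smoothExtension (hunit y hy.1)).continuousAt.comp
      (f := fun y : ℝ => (y : ℂ)) Complex.continuous_ofReal.continuousAt).continuousWithinAt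
  rw [quadratureError, hI, map_sub, map_sum, ← φ.intervalIntegral_comp_comm hint]
  simp only [map_smul, smul_eq_mul]
  congr 1
  refine Finset.sum_congr rfl fun j _ => ?_
  rw [smoothFactor_eq_smoothExtension hRK hL x n (hG.mem_Ioo j).1 (hunit _ (hG.mem_Ioo j).1.le)]

/-- The error bound on an arbitrary admissible Bernstein ellipse. -/
theorem seminorm_quadratureError_le (hRK : RungeKuttaAssumption A b)
    (hconst : IsBoundConstants A b N ν β Cq) (hh : 0 < h) (hL : 0 < L₀) (x : ℝ) (n : ℕ) {Q : ℕ}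
    (hQ : 1 ≤ Q) {node weight : Fin Q → ℝ} (hG : IsGaussRule jacobiWeight Q node weight)
    {ρ : ℝ} (hρ : 1 < ρ) (hρ2 : 2 ≤ (ρ + ρ⁻¹) / 2)
    (hρβ : h * L₀ / 2 * ((ρ + ρ⁻¹) / 2 - 1) ≤ β) :
    N (quadratureError A b h L₀ x n node weight) ≤
      Cq * h * (4 * Real.sqrt L₀ / Real.pi) * (ρ⁻¹ ^ (2 * Q) * (ρ / (ρ - 1))) *
        Real.exp (growth |x| ν (n * h) L₀ * ((ρ + ρ⁻¹) / 2 - 1)) := by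
  set a := (ρ + ρ⁻¹) / 2
  -- A functional attaining `N` at the error and dominated by `N` reduces the vector estimate to the
  -- scalar one without loss of constant.
  obtain ⟨φ₀, hφ, hφN⟩ := exists_dual_eq_seminorm N (quadratureError A b h L₀ x n node weight)
  let φ : (Fin (s + 1) → ℂ) →L[ℂ] ℂ := LinearMap.toContinuousLinearMap φ₀
  have hφ' : ‖φ (quadratureError A b h L₀ x n node weight)‖ =
    N (quadratureError A b h L₀ x n node weight) := hφ
  rw [← hφ', dual_quadratureError hRK hconst hh hL x n hG]
  refine (hG.norm_error_le_of_differentiableAt hQ jacobiWeight_nonneg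
    intervalIntegrable_jacobiWeight (f := fun z => φ (smoothExtension A b h L₀ x n z)) hρ
    (M := ‖extensionConst h L₀‖ * Cq * Real.exp (growth |x| ν (n * h) L₀ * (a - 1)))
    (fun z h1 h2 => ?_) (fun z hz => ?_)).trans (le_of_eq ?_)
  · have hu := hconst.defined _ ((re_argument_le hh hL (norm_joukowski_le h1 h2)).trans hρβ)
    exact φ.differentiableAt.comp _ (differentiableAt_smoothExtension hu)
  · exact (hφN _).trans (seminorm_smoothExtension_le hRK hconst hh hL x n hρ2 hρβ
      (norm_joukowski_le (by linarith) hz.le))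
  -- The constant is `4 · 2√2 · (h L₀ / (4π)) √(2 / L₀) = 4 h √L₀ / π`.
  · rw [integral_jacobiWeight, norm_extensionConst hh hL, Real.sqrt_div (by norm_num)]
    have hρ0 : ρ ≠ 0 := by linarith
    have hρ1 : ρ - 1 ≠ 0 := by linarith
    have e1 : (1 - ρ⁻¹)⁻¹ = ρ / (ρ - 1) := by
      rw [← inv_div]
      congr 1
      field_simp
    have e2 : Real.sqrt 2 * Real.sqrt 2 = 2 := Real.mul_self_sqrt (by norm_num)
    have e3 : L₀ / Real.sqrt L₀ = Real.sqrt L₀ := Real.div_sqrt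
    rw [e1]
    have hs : Real.sqrt L₀ ≠ 0 := (Real.sqrt_pos.2 hL).ne'
    have hπ := Real.pi_ne_zero
    linear_combination (h / Real.pi * Cq * Real.exp (growth |x| ν (n * h) L₀ * (a - 1)) *
      ρ⁻¹ ^ (2 * Q) * (ρ / (ρ - 1))) * (2 * (L₀ / Real.sqrt L₀) * e2 + 4 * e3)

end Bounds

/-! ### The parameters -/

lemma two_le_half_add_inv {ρ : ℝ} (hρ : 2 + Real.sqrt 3 ≤ ρ) : 2 ≤ (ρ + ρ⁻¹) / 2 := by
  have h3 : 0 ≤ Real.sqrt 3 := Real.sqrt_nonneg 3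
  have hinv : (2 + Real.sqrt 3)⁻¹ = 2 - Real.sqrt 3 := by
    refine inv_eq_of_mul_eq_one_right ?_
    linear_combination -Real.sq_sqrt (show (0 : ℝ) ≤ 3 by norm_num)
  have := add_inv_le_add_inv (by linarith) hρ
  rw [hinv] at this
  linarith

/-- By this identity `ρ_max` is the parameter at which `h L₀ (a - 1) / 2` equals `β`. -/
lemma rhoMax_add_inv {β L₀ h : ℝ} (hβ : 0 < β) (hL : 0 < L₀) (hh : 0 < h) :
    (rhoMax β L₀ h + (rhoMax β L₀ h)⁻¹) / 2 - 1 = 2 * β / (L₀ * h) := by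
  rw [rhoMax]
  have e : 4 * β / (L₀ * h) = 2 * (2 * β / (L₀ * h)) := by ring
  rw [e]
  set c := 2 * β / (L₀ * h)
  have hc : 0 < c := by positivity
  have hinv : (1 + c + Real.sqrt (c ^ 2 + 2 * c))⁻¹ = 1 + c - Real.sqrt (c ^ 2 + 2 * c) := by
    refine inv_eq_of_mul_eq_one_right ?_
    linear_combination -Real.sq_sqrt (show 0 ≤ c ^ 2 + 2 * c by positivity)
  rw [hinv]
  ring

/-- This is the stationarity condition `D (ρ - ρ⁻¹) = 4Q` for `-2Q log ρ + D ((ρ + ρ⁻¹) / 2 - 1)`.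
-/
lemma rhoOpt_sub_inv (d ν t L₀ : ℝ) (Q : ℕ) :
    rhoOpt d ν t L₀ Q - (rhoOpt d ν t L₀ Q)⁻¹ = 2 * (2 * Q / growth d ν t L₀) := by
  rw [rhoOpt]
  set c := 2 * Q / growth d ν t L₀
  have hinv : (c + Real.sqrt (1 + c ^ 2))⁻¹ = Real.sqrt (1 + c ^ 2) - c := by
    refine inv_eq_of_mul_eq_one_right ?_
    linear_combination Real.sq_sqrt (show 0 ≤ 1 + c ^ 2 by positivity)
  rw [hinv]
  ring

/-- The choice `ρ = ρ_opt` in the error bound. -/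
lemma rhoOpt_bound {d ν t L₀ ρ : ℝ} {Q : ℕ} (hD : 0 ≤ growth d ν t L₀)
    (hρ : ρ = rhoOpt d ν t L₀ Q) (h1 : 1 < ρ) :
    ρ⁻¹ ^ (2 * Q) * Real.exp (growth d ν t L₀ * ((ρ + ρ⁻¹) / 2 - 1)) ≤
      (Real.exp 1 * growth d ν t L₀ / (4 * Q)) ^ (2 * Q) := by
  have hsub := rhoOpt_sub_inv d ν t L₀ Q
  rw [← hρ] at hsub
  have hinv0 : 0 < ρ⁻¹ := by positivity
  have hinv1 : ρ⁻¹ < 1 := inv_lt_one_of_one_lt₀ h1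
  set D := growth d ν t L₀
  -- For `D = 0`, division by zero gives `ρ_opt = 1` in place of `+∞`; either value lies outside the
  -- interval, so the case distinction is unaffected.
  have hDne : D ≠ 0 := by
    intro h0
    rw [h0, div_zero] at hsub
    linarith
  have hDpos : 0 < D := lt_of_le_of_ne hD hDne.symm
  have hmul : D * (ρ - ρ⁻¹) = 4 * Q := by
    rw [hsub]
    field_simp
    ring
  have hQ : (0 : ℝ) < 4 * Q := by
    rw [← hmul]
    exact mul_pos hDpos (by linarith)
  have hle : ρ⁻¹ ≤ D / (4 * Q) := by
    rw [le_div_iff₀ hQ, ← hmul, inv_mul_le_iff₀ (by linarith), mul_comm ρ]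
    exact mul_le_mul_of_nonneg_left (by linarith) hD
  -- Since `ρ⁻¹ ≤ 1`, the exponent is at most `D (ρ - ρ⁻¹) / 2 = 2Q`.
  have hexp : Real.exp (D * ((ρ + ρ⁻¹) / 2 - 1)) ≤ Real.exp 1 ^ (2 * Q) := by
    rw [← Real.exp_nat_mul, mul_one]
    refine Real.exp_le_exp.2 ?_
    push_cast
    have h2 : D * ((ρ + ρ⁻¹) / 2 - 1) ≤ D * ((ρ - ρ⁻¹) / 2) :=
      mul_le_mul_of_nonneg_left (by linarith) hD
    linarith
  calc ρ⁻¹ ^ (2 * Q) * Real.exp (D * ((ρ + ρ⁻¹) / 2 - 1))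
      ≤ (D / (4 * Q)) ^ (2 * Q) * Real.exp 1 ^ (2 * Q) := by gcongr
    _ = (Real.exp 1 * D / (4 * Q)) ^ (2 * Q) := by
        rw [← mul_pow]
        congr 1
        ring

end SchrodingerCQ

end

/-! ### The two choices of the ellipse -/

theorem theorem4p4 {s : ℕ} (A : Matrix (Fin (s + 1)) (Fin (s + 1)) ℝ) (b : Fin (s + 1) → ℝ)
    (hRK : SchrodingerCQ.RungeKuttaAssumption A b)
    (N : Seminorm ℂ (Fin (s + 1) → ℂ)) (hN : ∀ v, N v = 0 → v = 0)
    (ν β Cq : ℝ) (hconst : SchrodingerCQ.IsBoundConstants A b N ν β Cq)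
    (h L₀ : ℝ) (hh : 0 < h) (hL : 0 < L₀) (x : ℝ) (n Q : ℕ) (hQ : 1 ≤ Q)
    (node weight : Fin Q → ℝ)
    (hG : SchrodingerCQ.IsGaussRule SchrodingerCQ.jacobiWeight Q node weight)
    (d t ρmax ρopt : ℝ) (hd : d = |x|) (ht : t = n * h)
    (hρmax : ρmax = SchrodingerCQ.rhoMax β L₀ h)
    (hρopt : ρopt = SchrodingerCQ.rhoOpt d ν t L₀ Q) :
    (ρopt ∈ Set.Ioo (2 + Real.sqrt 3) ρmax →
      N (SchrodingerCQ.quadratureError A b h L₀ x n node weight) ≤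
        Cq * h * (4 * Real.sqrt L₀ / Real.pi) * (ρopt / (ρopt - 1)) *
          (Real.exp 1 * (d * Real.sqrt (3 * L₀ / 2) + ν * t * L₀ / 2) / (4 * Q)) ^ (2 * Q)) ∧
    (ρopt ∉ Set.Ioo (2 + Real.sqrt 3) ρmax → 2 + Real.sqrt 3 ≤ ρmax →
      N (SchrodingerCQ.quadratureError A b h L₀ x n node weight) ≤
        Cq * h * (4 * Real.sqrt L₀ / Real.pi) *
          (ρmax ^ (-2 * (Q : ℤ) + 1) / (ρmax - 1)) *
          Real.exp (β / h * (d * Real.sqrt (6 / L₀) + ν * t))) := by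
  have hβ := hconst.beta_pos
  have hν : 0 < ν := by linarith [hconst.one_lt_nu]
  have hD : 0 ≤ SchrodingerCQ.growth d ν t L₀ := by
    rw [SchrodingerCQ.growth, hd, ht]
    positivity
  have h3 : 0 ≤ Real.sqrt 3 := Real.sqrt_nonneg 3
  have hmax := SchrodingerCQ.rhoMax_add_inv hβ hL hh
  rw [← hρmax] at hmax
  have hbound : ∀ ρ, 2 + Real.sqrt 3 ≤ ρ → ρ ≤ ρmax →
      N (SchrodingerCQ.quadratureError A b h L₀ x n node weight) ≤
        Cq * h * (4 * Real.sqrt L₀ / Real.pi) * (ρ⁻¹ ^ (2 * Q) * (ρ / (ρ - 1))) *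
          Real.exp (SchrodingerCQ.growth d ν t L₀ * ((ρ + ρ⁻¹) / 2 - 1)) := by
    intro ρ h1 h2
    rw [hd, ht]
    refine SchrodingerCQ.seminorm_quadratureError_le hRK hconst hh hL x n hQ hG (by linarith)
      (SchrodingerCQ.two_le_half_add_inv h1) ?_
    have h4 := SchrodingerCQ.add_inv_le_add_inv (by linarith) h2
    calc h * L₀ / 2 * ((ρ + ρ⁻¹) / 2 - 1) ≤ h * L₀ / 2 * (2 * β / (L₀ * h)) := by
          rw [← hmax]
          gcongr
      _ = β := by field_simp
  refine ⟨fun hopt => ?_, fun _ hle => ?_⟩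
  · have h1 : 1 < ρopt := by linarith [hopt.1]
    refine (hbound ρopt hopt.1.le hopt.2.le).trans ?_
    have h4 := SchrodingerCQ.rhoOpt_bound hD hρopt h1
    have hC : 0 ≤ Cq * h * (4 * Real.sqrt L₀ / Real.pi) * (ρopt / (ρopt - 1)) := by
      have := hconst.Cq_pos
      have h5 : 0 < ρopt - 1 := by linarith
      positivity
    calc _ = Cq * h * (4 * Real.sqrt L₀ / Real.pi) * (ρopt / (ρopt - 1)) *
          (ρopt⁻¹ ^ (2 * Q) *
            Real.exp (SchrodingerCQ.growth d ν t L₀ * ((ρopt + ρopt⁻¹) / 2 - 1))) := by ring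
      _ ≤ _ := mul_le_mul_of_nonneg_left h4 hC
  · refine (hbound ρmax hle le_rfl).trans (le_of_eq ?_)
    have h0 : ρmax ≠ 0 := by linarith
    -- At `ρ_max` the exponent is `D · 2β / (L₀ h)`; this identity puts it in the stated form.
    have hsq : Real.sqrt (6 / L₀) = Real.sqrt (3 * L₀ / 2) * (2 / L₀) := by
      rw [Real.sqrt_eq_iff_mul_self_eq (by positivity) (by positivity)]
      have h6 := Real.mul_self_sqrt (show 0 ≤ 3 * L₀ / 2 by positivity)
      symm
      calc _ = Real.sqrt (3 * L₀ / 2) * Real.sqrt (3 * L₀ / 2) * (2 / L₀) ^ 2 := by ring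
        _ = 6 / L₀ := by
          rw [h6]
          field_simp
          norm_num
    have hpow : ρmax ^ (-2 * (Q : ℤ) + 1) = ρmax⁻¹ ^ (2 * Q) * ρmax := by
      rw [zpow_add₀ h0, zpow_one, neg_mul, _root_.zpow_neg, inv_pow]
      norm_cast
    rw [hmax, hsq, hpow, SchrodingerCQ.growth, mul_div_assoc (ρmax⁻¹ ^ (2 * Q))]
    congr 2
    generalize Real.sqrt (3 * L₀ / 2) = v
    field_simp
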